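/- For a Borel probability measure $\mu$ on $\mathbb{R}^d$, let $C_{LS}(\mu)\in[0,\infty]$ be its log-Sobolev constant, i.e. the smallest constant $C\in[0,\infty)$ such that $$\int f^2\log f^2\,d\mu-\int f^2\,d\mu\,\log\Big(\int f^2\,d\mu\Big)\le 2C\int|\nabla f|^2\,d\mu$$ for all smooth compactly supported $f:\mathbb{R}^d\to\mathbb{R}$ (with $0\log 0=0$), and $C_{LS}(\mu)=\infty$ if there is no such constant. Let $\mu$ be a Borel probability measure on $\mathbb{R}^d$, let $X_1,X_2,\ldots$ be i.i.d. random vectors with law $\mu$, and for $n\ge1$ let $\nu_n$ be the law of $S_n=\frac1{\sqrt n}\sum_{i=1}^nX_i$. Then the sequence $(C_{LS}(\nu_n))_{n\ge1}$ is weakly decreasing in $n$, i.e. $C_{LS}(\nu_n)\le C_{LS}(\nu_m)$ in $[0,\infty]$ whenever $n\ge m\ge1$. -/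

import Mathlib

open MeasureTheory ProbabilityTheory
open scoped ENNReal NNReal

noncomputable section

/-- The entropy functional `Ent_μ(g) = ∫ g log g dμ - (∫ g dμ) log (∫ g dμ)`, with the convention
`0 log 0 = 0`. It is only used for nonnegative continuous compactly supported `g` and
probability measures `μ`, where both integrals exist and are finite. -/
def entropy {E : Type*} [MeasurableSpace E] (μ : Measure E) (g : E → ℝ) : ℝ :=
  (∫ x, g x * Real.log (g x) ∂μ) - (∫ x, g x ∂μ) * Real.log (∫ x, g x ∂μ)

/-- `μ` satisfies the logarithmic Sobolev inequality with constant `C`: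
`Ent_μ(f²) ≤ 2 C ∫ |∇f|² dμ` for all test functions `f ∈ C_c^∞(ℝ^d)`.
For a probability measure, cut-off and mollification extend the inequality, with the same `C`, to
all `C¹` functions `f` for which `f` and `|∇f|` are square integrable. -/
def SatisfiesLogSobolev {d : ℕ} (μ : Measure (EuclideanSpace ℝ (Fin d))) (C : ℝ≥0) : Prop :=
  ∀ f : EuclideanSpace ℝ (Fin d) → ℝ, ContDiff ℝ (⊤ : ℕ∞) f → HasCompactSupport f →
    entropy μ (fun x => f x ^ 2) ≤ 2 * (C : ℝ) * ∫ x, ‖gradient f x‖ ^ 2 ∂μ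

/-- The log-Sobolev constant `C_LS(μ) ∈ [0, ∞]`: the smallest constant in the logarithmic Sobolev
inequality, and `∞` if the inequality holds with no constant. -/
def logSobolevConst {d : ℕ} (μ : Measure (EuclideanSpace ℝ (Fin d))) : ℝ≥0∞ :=
  ⨅ (C : ℝ≥0) (_ : SatisfiesLogSobolev μ C), (C : ℝ≥0∞)

end

open Filter Topology

/-! It suffices to pass from `m` to `m + 1` summands, keeping the constant `C`. Let `F = f²(S)` with
`S` the normalized sum of `m + 1` variables, and let `g(X i)` be its conditional expectation given
one summand; `g` does not depend on `i`. Given `X i`, the function `F` depends on the other `m`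
variables only through their sum, so the inequality for `m` bounds the conditional entropy;
rescaling gains a factor `m/(m+1)`. By the chain rule this bounds `Ent F - Ent g` by `2C · m/(m+1) ·
E|∇f(S)|²`.

Superadditivity, `(m+1) Ent g ≤ Ent F` (`card_mul_entropy_le_entropy`), gives `Ent F - Ent g ≥
m/(m+1) · Ent F`. The two factors cancel exactly. -/

/-! ### Superadditivity of entropy -/

/-- A continuous function of a bounded random variable is integrable. -/
theorem integrable_continuousOn_comp {α : Type*} [MeasurableSpace α] {μ : Measure α}
    [IsFiniteMeasure μ] {g : α → ℝ} {a b : ℝ} (hg : AEStronglyMeasurable g μ)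
    (hab : ∀ x, g x ∈ Set.Icc a b) {q : ℝ → ℝ} (hq : Measurable q)
    (hqc : ContinuousOn q (Set.Icc a b)) : Integrable (fun x => q (g x)) μ := by
  obtain ⟨B, hB⟩ := isCompact_Icc.exists_bound_of_continuousOn hqc
  exact Integrable.of_bound (hq.comp_aemeasurable hg.aemeasurable).aestronglyMeasurable B
    (ae_of_all _ fun x => hB _ (hab x))

/-- This is `log t ≤ t - 1` at `t = b / a`: the pointwise form of Gibbs' inequality. -/
theorem mul_log_sub_mul_log_ge {a b : ℝ} (ha : 0 < a) (hb : 0 < b) :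
    a - b ≤ a * Real.log a - a * Real.log b := by
  have h := Real.log_le_sub_one_of_pos (div_pos hb ha)
  rw [Real.log_div hb.ne' ha.ne'] at h
  have h2 := mul_le_mul_of_nonneg_left h ha.le
  have h3 : a * (b / a - 1) = b - a := by field_simp
  linarith

/-- Superadditivity of entropy over independent variables, for functions bounded away from zero. -/
theorem card_mul_entropy_le_entropy_of_pos {ι Ω E : Type*} [Fintype ι] [MeasurableSpace Ω]
    [MeasurableSpace E] {P : Measure Ω} [IsProbabilityMeasure P] {μ : Measure E}
    [IsProbabilityMeasure μ] {X : ι → Ω → E} (hlaw : ∀ i, HasLaw (X i) μ P)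
    (hindep : iIndepFun X P) {F : Ω → ℝ} (hF : AEStronglyMeasurable F P) {g : E → ℝ}
    (hg : Measurable g) {ε K : ℝ} (hε : 0 < ε) (hFb : ∀ ω, F ω ∈ Set.Icc ε K)
    (hgb : ∀ x, g x ∈ Set.Icc ε K) (hint : ∫ ω, F ω ∂P = ∫ x, g x ∂μ)
    (hlog : ∀ i, ∫ ω, F ω * Real.log (g (X i ω)) ∂P = ∫ x, g x * Real.log (g x) ∂μ) :
    Fintype.card ι * entropy μ g ≤ entropy P F := by
  have hlogc : ContinuousOn Real.log (Set.Icc ε K) :=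
    Real.continuousOn_log.mono fun x hx => (hε.trans_le hx.1).ne'
  have hgi : Integrable g μ :=
    integrable_continuousOn_comp hg.aestronglyMeasurable hgb measurable_id continuousOn_id
  have hFi : Integrable F P :=
    integrable_continuousOn_comp hF hFb measurable_id continuousOn_id
  have hFlog : Integrable (fun ω => F ω * Real.log (F ω)) P :=
    integrable_continuousOn_comp hF hFb (q := fun t => t * Real.log t) (by fun_prop)
      (by exact Real.continuous_mul_log.continuousOn)
  set c := ∫ x, g x ∂μ with hc
  have hcpos : 0 < c := by
    refine hε.trans_le ?_
    have := integral_mono (integrable_const ε) hgi fun x => (hgb x).1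
    simpa using this
  have hgX : ∀ i, AEStronglyMeasurable (fun ω => g (X i ω)) P := fun i =>
    (hg.comp_aemeasurable (hlaw i).aemeasurable).aestronglyMeasurable
  have hFgX : ∀ i, Integrable (fun ω => F ω * Real.log (g (X i ω))) P := fun i => by
    obtain ⟨B, hB⟩ := isCompact_Icc.exists_bound_of_continuousOn hlogc
    exact hFi.mul_bdd
      (Real.measurable_log.comp_aemeasurable (hgX i).aemeasurable).aestronglyMeasurable
      (ae_of_all _ fun ω => hB _ (hgb _))
  -- By independence `c * G` has the same mean `c` as `F`, so Gibbs' inequality says that `F` has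
  -- nonnegative relative entropy with respect to it; the logarithm of the product splits into the
  -- marginal terms.
  set G : Ω → ℝ := fun ω => ∏ i, (g (X i ω) / c) with hG
  have hGi : Integrable G P := by
    refine Integrable.of_bound ?_ (∏ _i : ι, (K / c)) (ae_of_all _ fun ω => ?_)
    · refine Finset.aestronglyMeasurable_fun_prod _ fun i _ => ?_
      exact (hg.div_const c |>.comp_aemeasurable (hlaw i).aemeasurable).aestronglyMeasurable
    · rw [Real.norm_of_nonneg]
      · refine Finset.prod_le_prod (fun i _ => ?_) fun i _ => ?_
        · exact (div_pos (hε.trans_le (hgb _).1) hcpos).le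
        · exact div_le_div_of_nonneg_right (hgb _).2 hcpos.le
      · exact Finset.prod_nonneg fun i _ => (div_pos (hε.trans_le (hgb _).1) hcpos).le
  have hGint : ∫ ω, G ω ∂P = 1 := by
    have := hindep.integral_fun_prod_comp (f := fun _ x => g x / c)
      (fun i => (hlaw i).aemeasurable) (fun i => (hg.div_const c).aestronglyMeasurable)
    simp only [hG]
    rw [this]
    refine Finset.prod_eq_one fun i _ => ?_
    have h2 := (hlaw i).integral_comp (f := fun x => g x / c) (hg.div_const c).aestronglyMeasurable
    simp only [Function.comp_def] at h2
    rw [h2, integral_div, ← hc, div_self hcpos.ne']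
  have hpt : ∀ ω, F ω - c * G ω ≤ F ω * Real.log (F ω) -
      (F ω * Real.log c + ∑ i, (F ω * Real.log (g (X i ω)) - F ω * Real.log c)) := fun ω => by
    have hgp : ∀ i, 0 < g (X i ω) := fun i => hε.trans_le (hgb _).1
    have hGp : 0 < G ω := Finset.prod_pos fun i _ => div_pos (hgp i) hcpos
    have h1 := mul_log_sub_mul_log_ge (hε.trans_le (hFb ω).1) (mul_pos hcpos hGp)
    rw [Real.log_mul hcpos.ne' hGp.ne', Real.log_prod
      fun i _ => (div_pos (hgp i) hcpos).ne', mul_add, Finset.mul_sum] at h1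
    refine h1.trans_eq ?_
    congr 2
    refine Finset.sum_congr rfl fun i _ => ?_
    rw [Real.log_div (hgp i).ne' hcpos.ne', mul_sub]
  have hsummand : ∀ i,
      Integrable (fun ω => F ω * Real.log (g (X i ω)) - F ω * Real.log c) P := fun i =>
    (hFgX i).sub (hFi.mul_const _)
  have hsum : Integrable (fun ω => ∑ i, (F ω * Real.log (g (X i ω)) - F ω * Real.log c)) P :=
    integrable_finsetSum _ fun i _ => hsummand i
  have hadd : Integrable (fun ω => F ω * Real.log c +
      ∑ i, (F ω * Real.log (g (X i ω)) - F ω * Real.log c)) P := (hFi.mul_const _).add hsum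
  have key : ∫ ω, (F ω - c * G ω) ∂P ≤ ∫ ω, (F ω * Real.log (F ω) - (F ω * Real.log c +
      ∑ i, (F ω * Real.log (g (X i ω)) - F ω * Real.log c))) ∂P :=
    integral_mono (hFi.sub (hGi.const_mul c)) (hFlog.sub hadd) hpt
  rw [integral_sub hFi (hGi.const_mul c), integral_sub hFlog hadd,
    integral_add (hFi.mul_const _) hsum,
    integral_finsetSum _ fun i _ => hsummand i,
    integral_const_mul, hGint, hint, integral_mul_const, hint] at key
  have hterm : ∀ i, ∫ ω, (F ω * Real.log (g (X i ω)) - F ω * Real.log c) ∂P = entropy μ g := by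
    intro i
    rw [integral_sub (hFgX i) (hFi.mul_const _), hlog, integral_mul_const, hint, entropy]
  simp only [hterm, Finset.sum_const, Finset.card_univ, nsmul_eq_mul] at key
  rw [entropy.eq_def P F, hint]
  linarith

/-- Since `t log t` is continuous up to `t = 0`, dominated convergence applies. This removes the
positive lower bound assumed in the previous theorem. -/
theorem tendsto_entropy_add_const {α : Type*} [MeasurableSpace α] {μ : Measure α}
    [IsProbabilityMeasure μ] {g : α → ℝ} {K : ℝ} (hg : AEStronglyMeasurable g μ)
    (hgb : ∀ x, g x ∈ Set.Icc 0 K) :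
    Tendsto (fun n : ℕ => entropy μ (fun x => g x + 1 / ((n : ℝ) + 1))) atTop
      (𝓝 (entropy μ g)) := by
  have hlim : Tendsto (fun n : ℕ => 1 / ((n : ℝ) + 1)) atTop (𝓝 0) :=
    tendsto_one_div_add_atTop_nhds_zero_nat
  have hconv : ∀ q : ℝ → ℝ, Continuous q →
      Tendsto (fun n : ℕ => ∫ x, q (g x + 1 / ((n : ℝ) + 1)) ∂μ) atTop (𝓝 (∫ x, q (g x) ∂μ)) := by
    intro q hq
    obtain ⟨B, hB⟩ := (isCompact_Icc (a := (0 : ℝ)) (b := K + 1)).exists_bound_of_continuousOn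
      hq.continuousOn
    refine tendsto_integral_of_dominated_convergence (fun _ => B) (fun n => ?_)
      (integrable_const B) (fun n => ae_of_all _ fun x => hB _ ?_) (ae_of_all _ fun x => ?_)
    · exact hq.comp_aestronglyMeasurable (hg.add_const _)
    · have h1 : 0 < 1 / ((n : ℝ) + 1) := Nat.one_div_pos_of_nat
      have h2 : 1 / ((n : ℝ) + 1) ≤ 1 := by
        rw [div_le_one (by positivity)]; linarith [n.cast_nonneg (α := ℝ)]
      exact ⟨by linarith [(hgb x).1], by linarith [(hgb x).2]⟩
    · have h := (hq.tendsto (g x + 0)).comp (tendsto_const_nhds.add hlim)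
      simpa [Function.comp_def] using h
  have h1 := hconv _ Real.continuous_mul_log
  have h2 := hconv _ continuous_id
  exact h1.sub ((Real.continuous_mul_log.tendsto _).comp h2)

/-- Superadditivity of entropy over independent variables: if the conditional expectation of `F`
given each of the i.i.d. variables `X i` is `g (X i)`, then `n Ent(g) ≤ Ent(F)`. -/
theorem card_mul_entropy_le_entropy {ι Ω E : Type*} [Fintype ι] [Nonempty ι] [MeasurableSpace Ω]
    [MeasurableSpace E] {P : Measure Ω} [IsProbabilityMeasure P] {μ : Measure E}
    [IsProbabilityMeasure μ] {X : ι → Ω → E} (hlaw : ∀ i, HasLaw (X i) μ P)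
    (hindep : iIndepFun X P) {F : Ω → ℝ} (hF : AEStronglyMeasurable F P) {g : E → ℝ}
    (hg : Measurable g) {K : ℝ} (hFb : ∀ ω, F ω ∈ Set.Icc 0 K)
    (hgb : ∀ x, g x ∈ Set.Icc 0 K)
    (hcond : ∀ i (h : E → ℝ), Measurable h → (∃ B, ∀ x, ‖h x‖ ≤ B) →
      ∫ ω, F ω * h (X i ω) ∂P = ∫ x, g x * h x ∂μ) :
    Fintype.card ι * entropy μ g ≤ entropy P F := by
  refine le_of_tendsto_of_tendsto
    ((tendsto_entropy_add_const hg.aestronglyMeasurable hgb).const_mul _)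
    (tendsto_entropy_add_const hF hFb) (Eventually.of_forall fun n => ?_)
  set ε : ℝ := 1 / ((n : ℝ) + 1) with hε
  have hε0 : 0 < ε := Nat.one_div_pos_of_nat
  have hFi : Integrable F P :=
    integrable_continuousOn_comp hF hFb measurable_id continuousOn_id
  have hgi : Integrable g μ :=
    integrable_continuousOn_comp hg.aestronglyMeasurable hgb measurable_id continuousOn_id
  have hcond' : ∀ i (h : E → ℝ), Measurable h → (∃ B, ∀ x, ‖h x‖ ≤ B) →
      ∫ ω, (F ω + ε) * h (X i ω) ∂P = ∫ x, (g x + ε) * h x ∂μ := by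
    rintro i h hm ⟨B, hB⟩
    have hhi : Integrable h μ := .of_bound hm.aestronglyMeasurable B (ae_of_all _ hB)
    have hhX : AEStronglyMeasurable (fun ω => h (X i ω)) P :=
      (hm.comp_aemeasurable (hlaw i).aemeasurable).aestronglyMeasurable
    have hhXi : Integrable (fun ω => h (X i ω)) P := .of_bound hhX B (ae_of_all _ fun _ => hB _)
    have h2 := (hlaw i).integral_comp (f := h) hm.aestronglyMeasurable
    simp only [Function.comp_def] at h2
    simp only [add_mul]
    rw [integral_add (hFi.mul_bdd hhX (ae_of_all _ fun _ => hB _)) (hhXi.const_mul ε),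
      integral_add (hgi.mul_bdd hm.aestronglyMeasurable (ae_of_all _ hB)) (hhi.const_mul ε),
      hcond i h hm ⟨B, hB⟩, integral_const_mul, integral_const_mul, h2]
  have hgb' : ∀ x, g x + ε ∈ Set.Icc ε (K + ε) := fun x =>
    ⟨by linarith [(hgb x).1], by linarith [(hgb x).2]⟩
  refine card_mul_entropy_le_entropy_of_pos hlaw hindep (hF.add_const ε) (hg.add_const ε) hε0
    (K := K + ε) (fun ω => ⟨by linarith [(hFb ω).1], by linarith [(hFb ω).2]⟩) hgb' ?_ ?_
  -- The test function `1` gives equality of means, and `log (g + ε)`, bounded thanks to the shift,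
  -- gives the logarithmic identity.
  · simpa only [mul_one] using hcond' (Classical.arbitrary ι) (fun _ => 1) measurable_const ⟨1, by simp⟩
  · intro i
    obtain ⟨B, hB⟩ := (isCompact_Icc (a := ε) (b := K + ε)).exists_bound_of_continuousOn
      (Real.continuousOn_log.mono fun x hx => (hε0.trans_le hx.1).ne')
    exact hcond' i (fun x => Real.log (g x + ε)) (by fun_prop) ⟨B, fun x => hB _ (hgb' x)⟩

/-! ### Laws of sums -/

/-- The law of a sum of i.i.d. variables depends only on the number of summands. -/
theorem map_sum_eq_of_card_eq {ι Ω E : Type*} [MeasurableSpace Ω] [AddCommMonoid E]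
    [MeasurableSpace E] [MeasurableAdd₂ E] {P : Measure Ω} [IsProbabilityMeasure P]
    {μ : Measure E} {X : ι → Ω → E} (hlaw : ∀ i, HasLaw (X i) μ P) (hindep : iIndepFun X P)
    {s t : Finset ι} (hst : s.card = t.card) :
    P.map (fun ω => ∑ i ∈ s, X i ω) = P.map (fun ω => ∑ i ∈ t, X i ω) := by
  classical
  -- Each new index convolves the law with the same `μ`, whichever index it is.
  have hstep : ∀ (s : Finset ι) (a : ι), a ∉ s →
      P.map (fun ω => ∑ i ∈ insert a s, X i ω) = (P.map fun ω => ∑ i ∈ s, X i ω).conv μ := by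
    intro s a ha
    have h := hindep.indepFun_finsetSum_of_notMem₀ (fun i => (hlaw i).aemeasurable) ha
    have h2 := h.map_add_eq_map_conv_map₀
      (Finset.aemeasurable_sum s fun i _ => (hlaw i).aemeasurable) (hlaw a).aemeasurable
    rw [(hlaw a).map_eq] at h2
    have e1 : (fun ω => ∑ i ∈ insert a s, X i ω) = (∑ i ∈ s, X i) + X a := by
      ext ω; simp [Finset.sum_insert ha, add_comm]
    have e2 : (fun ω => ∑ i ∈ s, X i ω) = ∑ i ∈ s, X i := by ext ω; simp
    rw [e1, e2, h2]
  induction s using Finset.induction_on generalizing t with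
  | empty =>
    rw [Finset.card_empty] at hst
    rw [Finset.card_eq_zero.1 hst.symm]
  | insert a s ha ih =>
    rw [Finset.card_insert_of_notMem ha] at hst
    obtain ⟨b, u, hbu, rfl, hu⟩ := Finset.card_eq_succ.1 hst.symm
    rw [hstep s a ha, hstep u b hbu, ih hu.symm]

/-! ### Affine changes of variables -/

theorem gradient_comp_smul_add {E : Type*} [NormedAddCommGroup E] [InnerProductSpace ℝ E]
    [CompleteSpace E] {f : E → ℝ} (hf : Differentiable ℝ f) (a : E) (b : ℝ) (y : E) :
    gradient (fun y => f (a + b • y)) y = b • gradient f (a + b • y) := by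
  refine HasGradientAt.gradient ?_
  rw [hasGradientAt_iff_hasFDerivAt]
  have h1 := (hf (a + b • y)).hasFDerivAt.comp y (((hasFDerivAt_id y).const_smul b).const_add a)
  refine (show HasFDerivAt (fun y => f (a + b • y)) _ y from h1).congr_fderiv ?_
  ext z
  simp [gradient]

/-- Affine changes of variables in the logarithmic Sobolev inequality. -/
theorem SatisfiesLogSobolev.entropy_comp_smul_add {d : ℕ}
    {ν : Measure (EuclideanSpace ℝ (Fin d))} {r : ℝ} {C : ℝ≥0}
    (hLS : SatisfiesLogSobolev (ν.map fun y => r⁻¹ • y) C) {f : EuclideanSpace ℝ (Fin d) → ℝ}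
    (hf : ContDiff ℝ (⊤ : ℕ∞) f) (hfc : HasCompactSupport f) {s : ℝ} (hr : r ≠ 0)
    (hs : s ≠ 0) (a : EuclideanSpace ℝ (Fin d)) :
    entropy ν (fun y => f (s • (a + y)) ^ 2) ≤
      2 * (C : ℝ) * ((s * r) ^ 2 * ∫ y, ‖gradient f (s • (a + y))‖ ^ 2 ∂ν) := by
  have hsr : s * r ≠ 0 := mul_ne_zero hs hr
  have hemb : Topology.IsClosedEmbedding fun y : EuclideanSpace ℝ (Fin d) => s • a + (s * r) • y :=
    ((Homeomorph.smulOfNeZero _ hsr).trans (Homeomorph.addLeft (s • a))).isClosedEmbedding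
  -- This test function turns the normalized variable `r⁻¹ • y` into `s • (a + y)`; its gradient
  -- contributes `(s * r) ^ 2`.
  have h := hLS (fun y => f (s • a + (s * r) • y))
    (hf.comp (contDiff_const.add (contDiff_id.const_smul _))) (hfc.comp_isClosedEmbedding hemb)
  have hmeas : AEMeasurable (fun y : EuclideanSpace ℝ (Fin d) => r⁻¹ • y) ν := by fun_prop
  have hcont : Continuous fun y : EuclideanSpace ℝ (Fin d) => s • a + (s * r) • y :=
    hemb.continuous
  have hgrad : Continuous (gradient f) :=
    (InnerProductSpace.toDual ℝ _).symm.continuous.comp (hf.continuous_fderiv (by simp))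
  have hcancel : ∀ y : EuclideanSpace ℝ (Fin d), s • a + (s * r) • r⁻¹ • y = s • (a + y) := by
    intro y
    rw [smul_smul, mul_assoc, mul_inv_cancel₀ hr, mul_one, smul_add]
  have hfm : Measurable fun y => f (s • a + (s * r) • y) := (hf.continuous.comp hcont).measurable
  simp only [gradient_comp_smul_add (hf.differentiable (by simp)), norm_smul, mul_pow,
    integral_const_mul, Real.norm_eq_abs, sq_abs] at h
  simp only [entropy] at h ⊢
  rw [integral_map hmeas (by
      exact ((hfm.pow_const 2).mul (hfm.pow_const 2).log).aestronglyMeasurable),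
    integral_map hmeas (by exact (hfm.pow_const 2).aestronglyMeasurable),
    integral_map hmeas (by exact ((hgrad.comp hcont).norm.pow 2).aestronglyMeasurable)] at h
  simp only [hcancel] at h
  simpa only [mul_pow] using h

/-! ### Adding a summand -/

/-- The pair formed by one of `m + 1` i.i.d. variables and the sum of the others has the product
law. -/
theorem map_prodMk_sum_erase {Ω E : Type*} [MeasurableSpace Ω] [AddCommMonoid E]
    [MeasurableSpace E] [MeasurableAdd₂ E] {P : Measure Ω} [IsProbabilityMeasure P]
    {μ : Measure E} {X : ℕ → Ω → E} (hlaw : ∀ i, HasLaw (X i) μ P) (hindep : iIndepFun X P)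
    {m i : ℕ} (hi : i ∈ Finset.range (m + 1)) :
    HasLaw (fun ω => (X i ω, ∑ j ∈ (Finset.range (m + 1)).erase i, X j ω))
      (μ.prod (P.map fun ω => ∑ j ∈ Finset.range m, X j ω)) P := by
  have hX : ∀ j, AEMeasurable (X j) P := fun j => (hlaw j).aemeasurable
  have hS : AEMeasurable (fun ω => ∑ j ∈ (Finset.range (m + 1)).erase i, X j ω) P :=
    Finset.aemeasurable_fun_sum _ fun j _ => hX j
  refine ⟨(hX i).prodMk hS, ?_⟩
  have h := (hindep.indepFun_finsetSum_of_notMem₀ hX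
    (Finset.notMem_erase i (Finset.range (m + 1)))).symm
  rw [show (∑ j ∈ (Finset.range (m + 1)).erase i, X j) =
    fun ω => ∑ j ∈ (Finset.range (m + 1)).erase i, X j ω by ext ω; simp] at h
  rw [(indepFun_iff_map_prod_eq_prod_map_map (hX i) hS).1 h, (hlaw i).map_eq,
    map_sum_eq_of_card_eq hlaw hindep (t := Finset.range m)
      (by rw [Finset.card_erase_of_mem hi]; simp)]

/-- Adding one more i.i.d. summand preserves the logarithmic Sobolev inequality. -/
theorem SatisfiesLogSobolev.succ {d : ℕ} {μ : Measure (EuclideanSpace ℝ (Fin d))}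
    [IsProbabilityMeasure μ] {Ω : Type*} [MeasurableSpace Ω] {P : Measure Ω}
    [IsProbabilityMeasure P] {X : ℕ → Ω → EuclideanSpace ℝ (Fin d)}
    (hlaw : ∀ i, HasLaw (X i) μ P) (hindep : iIndepFun X P) {m : ℕ} (hm : 0 < m) {C : ℝ≥0}
    (hLS : SatisfiesLogSobolev
      (P.map fun ω => (1 / Real.sqrt (m : ℝ)) • ∑ i ∈ Finset.range m, X i ω) C) :
    SatisfiesLogSobolev (P.map fun ω =>
      (1 / Real.sqrt ((m + 1 : ℕ) : ℝ)) • ∑ i ∈ Finset.range (m + 1), X i ω) C := by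
  intro f hf hfc
  have hm' : (0 : ℝ) < m := by exact_mod_cast hm
  have hX : ∀ j, AEMeasurable (X j) P := fun j => (hlaw j).aemeasurable
  have hSm : ∀ k, AEMeasurable (fun ω => ∑ i ∈ Finset.range k, X i ω) P := fun k =>
    Finset.aemeasurable_fun_sum _ fun j _ => hX j
  set ν := P.map fun ω => ∑ i ∈ Finset.range m, X i ω with hν
  have : IsProbabilityMeasure ν := Measure.isProbabilityMeasure_map (hSm m)
  set r := Real.sqrt (m : ℝ) with hr
  have hr0 : r ≠ 0 := (Real.sqrt_pos.2 hm').ne'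
  set s := 1 / Real.sqrt ((m + 1 : ℕ) : ℝ) with hs
  have hs0 : s ≠ 0 := (one_div_pos.2 (Real.sqrt_pos.2 (by positivity))).ne'
  -- The gain from renormalizing `m` summands inside a sum of `m + 1`.
  have hsr : (s * r) ^ 2 = m / (m + 1) := by
    rw [mul_pow, hs, hr, div_pow, Real.sq_sqrt hm'.le, Real.sq_sqrt (by positivity)]
    push_cast
    ring
  have hLS' : SatisfiesLogSobolev (ν.map fun y => r⁻¹ • y) C := by
    rw [hν, AEMeasurable.map_map_of_aemeasurable (by fun_prop) (hSm m)]
    simpa only [one_div, Function.comp_def] using hLS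
  -- notation for the functions of `X i + ∑_{j ≠ i} X j`
  set q : EuclideanSpace ℝ (Fin d) → ℝ := fun z => f (s • z) ^ 2 with hq
  set D : EuclideanSpace ℝ (Fin d) → ℝ := fun z => ‖gradient f (s • z)‖ ^ 2 with hD
  have hsc : Continuous fun z : EuclideanSpace ℝ (Fin d) => s • z := continuous_const_smul s
  have hqc : Continuous q := (hf.continuous.comp hsc).pow 2
  have hgrad : Continuous (gradient f) :=
    (InnerProductSpace.toDual ℝ _).symm.continuous.comp (hf.continuous_fderiv (by simp))
  have hDc : Continuous D := ((hgrad.comp hsc).norm).pow 2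
  obtain ⟨B, hB⟩ := hfc.exists_bound_of_continuous hf.continuous
  obtain ⟨B', hB'⟩ := (hfc.fderiv (𝕜 := ℝ)).exists_bound_of_continuous
    (hf.continuous_fderiv (by simp))
  have hqb : ∀ z, q z ∈ Set.Icc 0 (B ^ 2) := fun z =>
    ⟨sq_nonneg _, by
      have := pow_le_pow_left₀ (norm_nonneg _) (hB (s • z)) 2
      rwa [Real.norm_eq_abs, sq_abs] at this⟩
  have hDb : ∀ z, D z ∈ Set.Icc 0 (B' ^ 2) := fun z =>
    ⟨sq_nonneg _, pow_le_pow_left₀ (norm_nonneg _)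
      (by simpa [gradient] using hB' (s • z)) 2⟩
  -- sections and integrability
  have hint : ∀ {α : Type _} [MeasurableSpace α] {ρ : Measure α} [IsFiniteMeasure ρ]
      {u : α → ℝ} {K : ℝ}, AEStronglyMeasurable u ρ → (∀ x, u x ∈ Set.Icc 0 K) →
      Integrable u ρ := fun hu hb =>
    integrable_continuousOn_comp hu hb measurable_id continuousOn_id
  have hintlog : ∀ {α : Type _} [MeasurableSpace α] {ρ : Measure α} [IsFiniteMeasure ρ]
      {u : α → ℝ} {K : ℝ}, AEStronglyMeasurable u ρ → (∀ x, u x ∈ Set.Icc 0 K) →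
      Integrable (fun x => u x * Real.log (u x)) ρ := fun hu hb =>
    integrable_continuousOn_comp hu hb (q := fun t => t * Real.log t) (by fun_prop)
      (by exact Real.continuous_mul_log.continuousOn)
  have hq2 : Measurable fun p : EuclideanSpace ℝ (Fin d) × EuclideanSpace ℝ (Fin d) =>
    q (p.1 + p.2) := (hqc.comp continuous_add).measurable
  have hD2 : Measurable fun p : EuclideanSpace ℝ (Fin d) × EuclideanSpace ℝ (Fin d) =>
    D (p.1 + p.2) := (hDc.comp continuous_add).measurable
  have hqi : Integrable (fun p : EuclideanSpace ℝ (Fin d) × EuclideanSpace ℝ (Fin d) =>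
    q (p.1 + p.2)) (μ.prod ν) := hint hq2.aestronglyMeasurable fun p => hqb _
  have hqli : Integrable (fun p : EuclideanSpace ℝ (Fin d) × EuclideanSpace ℝ (Fin d) =>
      q (p.1 + p.2) * Real.log (q (p.1 + p.2))) (μ.prod ν) :=
    hintlog hq2.aestronglyMeasurable fun p => hqb _
  have hDi : Integrable (fun p : EuclideanSpace ℝ (Fin d) × EuclideanSpace ℝ (Fin d) =>
    D (p.1 + p.2)) (μ.prod ν) := hint hD2.aestronglyMeasurable fun p => hDb _
  set g : EuclideanSpace ℝ (Fin d) → ℝ := fun x => ∫ y, q (x + y) ∂ν with hg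
  have hgm : Measurable g := hq2.stronglyMeasurable.integral_prod_right.measurable
  have hgb : ∀ x, g x ∈ Set.Icc 0 (B ^ 2) := fun x => by
    refine ⟨integral_nonneg fun y => (hqb _).1, ?_⟩
    have h := integral_mono (hint (ρ := ν) (u := fun y => q (x + y))
      (hqc.comp (continuous_const_add x)).aestronglyMeasurable fun y => hqb _)
      (integrable_const (B ^ 2)) fun y => (hqb (x + y)).2
    simpa using h
  -- the conditional inequality
  have hcondLS : ∀ x, (∫ y, q (x + y) * Real.log (q (x + y)) ∂ν) - g x * Real.log (g x) ≤
      2 * (C : ℝ) * ((s * r) ^ 2 * ∫ y, D (x + y) ∂ν) := fun x =>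
    hLS'.entropy_comp_smul_add hf hfc hr0 hs0 x
  have hgl : Integrable (fun x => g x * Real.log (g x)) μ :=
    hintlog hgm.aestronglyMeasurable hgb
  have havg : (∫ p, q (p.1 + p.2) * Real.log (q (p.1 + p.2)) ∂(μ.prod ν)) -
      ∫ x, g x * Real.log (g x) ∂μ ≤
      2 * (C : ℝ) * ((s * r) ^ 2 * ∫ p, D (p.1 + p.2) ∂(μ.prod ν)) := by
    rw [integral_prod _ hqli, integral_prod _ hDi, ← integral_sub hqli.integral_prod_left hgl,
      ← integral_const_mul, ← integral_const_mul]
    exact integral_mono (hqli.integral_prod_left.sub hgl)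
      ((hDi.integral_prod_left.const_mul _).const_mul _) hcondLS
  -- transfer to `Ω`
  have hsum : ∀ i ∈ Finset.range (m + 1), ∀ ω,
      X i ω + ∑ j ∈ (Finset.range (m + 1)).erase i, X j ω = ∑ j ∈ Finset.range (m + 1), X j ω :=
    fun i hi ω => Finset.add_sum_erase _ (fun j => X j ω) hi
  have htrans : ∀ i ∈ Finset.range (m + 1),
      ∀ w : EuclideanSpace ℝ (Fin d) → EuclideanSpace ℝ (Fin d) → ℝ,
      Measurable (Function.uncurry w) →
      ∫ ω, w (X i ω) (∑ j ∈ Finset.range (m + 1), X j ω) ∂P =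
        ∫ p, w p.1 (p.1 + p.2) ∂(μ.prod ν) := fun i hi w hw => by
    have h := (map_prodMk_sum_erase hlaw hindep hi).integral_comp
      (f := fun p => w p.1 (p.1 + p.2)) (by
        exact (hw.comp (measurable_fst.prodMk
          (measurable_fst.add measurable_snd))).aestronglyMeasurable)
    simp only [Function.comp_def, hsum i hi] at h
    exact h
  have h0 : 0 ∈ Finset.range (m + 1) := by simp
  have hq1 : Measurable q := hqc.measurable
  have hsuper : (Fintype.card (Finset.range (m + 1)) : ℝ) * entropy μ g ≤
      entropy P fun ω => q (∑ j ∈ Finset.range (m + 1), X j ω) := by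
    have : Nonempty (Finset.range (m + 1)) := ⟨⟨0, h0⟩⟩
    refine card_mul_entropy_le_entropy (X := fun i : Finset.range (m + 1) => X i)
      (fun i => hlaw i) (hindep.precomp Subtype.val_injective)
      (hq1.comp_aemeasurable (hSm (m + 1))).aestronglyMeasurable hgm (fun ω => hqb _) hgb ?_
    rintro ⟨i, hi⟩ h hh ⟨K, hK⟩
    -- Integrating out the other summands by Fubini shows that `g (X i)` is the conditional
    -- expectation.
    refine (htrans i hi (fun x z => q z * h x)
      ((hq1.comp measurable_snd).mul (hh.comp measurable_fst))).trans ?_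
    rw [integral_prod]
    · simp only [integral_mul_const, hg]
    · exact hqi.mul_bdd (c := K) (hh.comp measurable_fst).aestronglyMeasurable
        (ae_of_all _ fun p => hK _)
  have hmean : ∫ ω, q (∑ j ∈ Finset.range (m + 1), X j ω) ∂P = ∫ x, g x ∂μ := by
    rw [htrans 0 h0 (fun _ z => q z) (hq1.comp measurable_snd), integral_prod _ hqi]
  have hlog : ∫ ω, q (∑ j ∈ Finset.range (m + 1), X j ω) *
      Real.log (q (∑ j ∈ Finset.range (m + 1), X j ω)) ∂P =
      ∫ p, q (p.1 + p.2) * Real.log (q (p.1 + p.2)) ∂(μ.prod ν) :=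
    htrans 0 h0 (fun _ z => q z * Real.log (q z)) ((hq1.mul hq1.log).comp measurable_snd)
  have hdir : ∫ ω, D (∑ j ∈ Finset.range (m + 1), X j ω) ∂P =
      ∫ p, D (p.1 + p.2) ∂(μ.prod ν) :=
    htrans 0 h0 (fun _ z => D z) (hDc.measurable.comp measurable_snd)
  have hS : AEMeasurable (fun ω => s • ∑ i ∈ Finset.range (m + 1), X i ω) P :=
    (hSm (m + 1)).const_smul s
  have hf2 : Measurable fun x => f x ^ 2 := (hf.continuous.pow 2).measurable
  simp only [entropy] at hsuper ⊢
  rw [integral_map hS (by exact (hf2.mul hf2.log).aestronglyMeasurable),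
    integral_map hS hf2.aestronglyMeasurable,
    integral_map hS (by exact (hgrad.norm.pow 2).aestronglyMeasurable)]
  change (∫ ω, q (∑ j ∈ Finset.range (m + 1), X j ω) *
      Real.log (q (∑ j ∈ Finset.range (m + 1), X j ω)) ∂P) -
    (∫ ω, q (∑ j ∈ Finset.range (m + 1), X j ω) ∂P) *
      Real.log (∫ ω, q (∑ j ∈ Finset.range (m + 1), X j ω) ∂P) ≤
    2 * (C : ℝ) * ∫ ω, D (∑ j ∈ Finset.range (m + 1), X j ω) ∂P
  rw [hmean, hlog] at hsuper ⊢
  rw [hdir]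
  rw [hsr] at havg
  simp only [Fintype.card_coe, Finset.card_range, Nat.cast_add, Nat.cast_one] at hsuper
  set A := ∫ p, q (p.1 + p.2) * Real.log (q (p.1 + p.2)) ∂(μ.prod ν)
  set G := ∫ x, g x * Real.log (g x) ∂μ
  set c := (∫ x, g x ∂μ) * Real.log (∫ x, g x ∂μ)
  set I := ∫ p, D (p.1 + p.2) ∂(μ.prod ν)
  -- Superadditivity reads `(m+1)(G - c) ≤ A - c`, that is, `m(A - c) ≤ (m+1)(A - G)`.
  have h1 : (m + 1 : ℝ) * (A - G) ≤ m * (2 * (C : ℝ) * I) := by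
    refine (mul_le_mul_of_nonneg_left havg (by positivity)).trans_eq ?_
    field_simp
  refine le_of_mul_le_mul_left ?_ hm'
  linarith

theorem theorem2 {d : ℕ} (μ : Measure (EuclideanSpace ℝ (Fin d))) [IsProbabilityMeasure μ]
    {Ω : Type*} [MeasurableSpace Ω] (P : Measure Ω) [IsProbabilityMeasure P]
    (X : ℕ → Ω → EuclideanSpace ℝ (Fin d))
    (hlaw : ∀ i, HasLaw (X i) μ P) (hindep : iIndepFun X P) :
    AntitoneOn
      (fun n : ℕ =>
        logSobolevConst (P.map (fun ω => (1 / Real.sqrt (n : ℝ)) • ∑ i ∈ Finset.range n, X i ω)))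
      (Set.Ici 1) := by
  intro m hm n _ hmn
  induction n, hmn using Nat.le_induction with
  | base => exact le_rfl
  | succ n hmn ih =>
    have hn : 0 < n := lt_of_lt_of_le hm hmn
    -- Every constant admissible for `n` is admissible for `n + 1`, so the infimum cannot increase.
    exact (iInf_mono fun C => iInf_mono' fun hLS =>
      ⟨hLS.succ hlaw hindep hn, le_rfl⟩).trans (ih hn)
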